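/- Let $(R,\mathfrak m,k)$ be a noetherian local ring (respectively, a standard graded algebra over a field $k$ with graded maximal ideal $\mathfrak m$). For a finitely generated (respectively, finitely generated graded) $R$-module $M$ with minimal (graded) free resolution $F$, let $\operatorname{lin}^R F$ be the associated graded complex of $F$ with respect to the filtration $(\mathcal G^nF)_i=\mathfrak m^{n-i}F_i$ (where $\mathfrak m^j=R$ for $j\le 0$), and let $$\operatorname{ld}_R M=\sup\{i : H_i(\operatorname{lin}^R F)\neq 0\}\in\{0,1,2,\dots\}\cup\{\infty\}$$ be the linearity defect of $M$ (with $\operatorname{ld}_R 0=0$). Let $\operatorname{pd}_R M$ denote the projective dimension of $M$. Let $0\to M\to P\to N\to 0$ be an exact sequence of nonzero finitely generated $R$-modules (respectively, of nonzero finitely generated graded $R$-modules and homogeneous maps of degree $0$). Then 1. $\operatorname{ld}_R N\le\min\{\max\{\operatorname{pd}_R P+1,\operatorname{ld}_R M+1\},\ \max\{\operatorname{ld}_R P,\operatorname{pd}_R M+1\}\}$; 2. $\operatorname{ld}_R P\le\min\{\max\{\operatorname{pd}_R M+1,\operatorname{ld}_R N\},\ \max\{\operatorname{ld}_R M,\operatorname{pd}_R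 N\}\}$; 3. $\operatorname{ld}_R M\le\min\{\max\{\operatorname{ld}_R N-1,\operatorname{pd}_R P\},\ \max\{\operatorname{pd}_R N,\operatorname{ld}_R P\}\}$. In particular: (a) If $P$ is free, then $\operatorname{ld}_R M=\operatorname{ld}_R N-1$ if $\operatorname{ld}_R N\ge 1$ (where $\infty-1=\infty$), and $\operatorname{ld}_R M=0$ otherwise. (b) If one of the modules $M$, $P$, $N$ has finite projective dimension, then the other two have both finite or both infinite linearity defect. -/

import Mathlib

universe u v w

noncomputable section

/-! ### Minimal free resolutions and their linear parts

Everything is relative to an ideal `m` of a commutative ring `R`; it is used for the maximal ideal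
of a noetherian local ring and for the graded maximal ideal of a standard graded algebra. -/

/-- A minimal free resolution
`⋯ → R ^ rank 2 → R ^ rank 1 → R ^ rank 0 → M → 0` of `M` by free modules of finite rank, with
`∂ (F (i + 1)) ⊆ m (F i)` for all `i`. -/
structure MinimalFreeResolution {R : Type u} [CommRing R] (m : Ideal R)
    (M : Type v) [AddCommGroup M] [Module R M] where
  /-- the ranks (Betti numbers) -/
  rank : ℕ → ℕ
  /-- the differential `F (i + 1) → F i` -/
  d : ∀ i : ℕ, (Fin (rank (i + 1)) → R) →ₗ[R] (Fin (rank i) → R)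
  /-- the augmentation `F 0 → M` -/
  ε : (Fin (rank 0) → R) →ₗ[R] M
  ε_surjective : Function.Surjective ε
  exact_zero : Function.Exact (d 0) ε
  exact_succ : ∀ i : ℕ, Function.Exact (d (i + 1)) (d i)
  minimal : ∀ i : ℕ, LinearMap.range (d i) ≤ m • (⊤ : Submodule R (Fin (rank i) → R))

namespace MinimalFreeResolution

variable {R : Type u} [CommRing R] {m : Ideal R} {M : Type v} [AddCommGroup M] [Module R M]

/-- The filtration `(𝒢ⁿ F)_i = m ^ (n - i) F_i`. The truncated subtraction of natural numbers is
intended, as `m ^ j = R` for `j ≤ 0`. -/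
def filtration (F : MinimalFreeResolution m M) (n i : ℕ) : Submodule R (Fin (F.rank i) → R) :=
  m ^ (n - i) • ⊤

/-- The differential maps `(𝒢ⁿ F)_(i + 1)` into `(𝒢ⁿ F)_i`. -/
theorem filtration_le_comap (F : MinimalFreeResolution m M) (n i : ℕ) :
    F.filtration n (i + 1) ≤ (F.filtration n i).comap (F.d i) := by
  rw [← Submodule.map_le_iff_le_comap, filtration, filtration, Submodule.map_smul'',
    Submodule.map_top]
  calc m ^ (n - (i + 1)) • LinearMap.range (F.d i)
      ≤ m ^ (n - (i + 1)) • (m • ⊤) := smul_mono_right _ (F.minimal i)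
    _ = m ^ (n - (i + 1) + 1) • ⊤ := by rw [← Submodule.mul_smul, ← pow_succ]
    _ ≤ m ^ (n - i) • ⊤ := Submodule.smul_mono_left (Ideal.pow_le_pow_right (by omega))

/-- The differential as a map `(𝒢ⁿ F)_(i + 1) → (𝒢ⁿ F)_i`. -/
def filtrationD (F : MinimalFreeResolution m M) (n i : ℕ) :
    F.filtration n (i + 1) →ₗ[R] F.filtration n i :=
  (F.d i).restrict (F.filtration_le_comap n i)

/-- `filtrationD` maps `(𝒢ⁿ⁺¹ F)_(i + 1)` into `(𝒢ⁿ⁺¹ F)_i`. -/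
theorem submoduleOf_le_comap (F : MinimalFreeResolution m M) (n i : ℕ) :
    (F.filtration (n + 1) (i + 1)).submoduleOf (F.filtration n (i + 1)) ≤
      ((F.filtration (n + 1) i).submoduleOf (F.filtration n i)).comap (F.filtrationD n i) :=
  fun _ hx => F.filtration_le_comap (n + 1) i hx

/-- The linear part of `F` is the associated graded complex of `F` for the filtration `𝒢`. Its
term in homological degree `i` is `⨁ n, linPart n i`, with
`linPart n i = (𝒢ⁿ F)_i / (𝒢ⁿ⁺¹ F)_i`. (For `n < 0` this quotient would be `0`.) -/
abbrev linPart (F : MinimalFreeResolution m M) (n i : ℕ) : Type u :=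
  F.filtration n i ⧸ (F.filtration (n + 1) i).submoduleOf (F.filtration n i)

/-- The differential of the linear part, in internal degree `n`. -/
def linPartD (F : MinimalFreeResolution m M) (n i : ℕ) :
    F.linPart n (i + 1) →ₗ[R] F.linPart n i :=
  Submodule.mapQ _ _ (F.filtrationD n i) (F.submoduleOf_le_comap n i)

/-- The cycles of the linear part in homological degree `i` and internal degree `n`. -/
def linCycles (F : MinimalFreeResolution m M) (n : ℕ) : ∀ i : ℕ, Submodule R (F.linPart n i)
  | 0 => ⊤
  | i + 1 => LinearMap.ker (F.linPartD n i)

/-- The boundaries of the linear part in homological degree `i` and internal degree `n`. -/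
def linBoundaries (F : MinimalFreeResolution m M) (n i : ℕ) : Submodule R (F.linPart n i) :=
  LinearMap.range (F.linPartD n i)

/-- The homology of the linear part in homological degree `i` and internal degree `n`. -/
abbrev linHomology (F : MinimalFreeResolution m M) (n i : ℕ) : Type u :=
  F.linCycles n i ⧸ (F.linBoundaries n i).submoduleOf (F.linCycles n i)

/-- `sup {i : H_i (lin F) ≠ 0}`, where the supremum of the empty set is `0`. Here
`H_i (lin F) = ⨁ n, linHomology n i`. -/
def linDefect (F : MinimalFreeResolution m M) : ℕ∞ :=
  ⨆ i ∈ {i : ℕ | ∃ n : ℕ, Nontrivial (F.linHomology n i)}, (i : ℕ∞)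

end MinimalFreeResolution

/-- The linearity defect of a finitely generated module over a noetherian local ring:
`sup {i : H_i (lin F) ≠ 0}` for the minimal free resolution `F` of `M`. The latter exists and is
unique up to isomorphism, so that the outer supremum is that of a constant family. -/
def lind (R : Type u) [CommRing R] [IsLocalRing R] (M : Type v) [AddCommGroup M] [Module R M] :
    ℕ∞ :=
  ⨆ F : MinimalFreeResolution (IsLocalRing.maximalIdeal R) M, F.linDefect

/-- The projective dimension of a module; it is `⊥` for the zero module only. -/
abbrev projdim (R : Type u) [CommRing R] (M : Type u) [AddCommGroup M] [Module R M] :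
    WithBot ℕ∞ :=
  CategoryTheory.projectiveDimension (ModuleCat.of R M)

/-! ### The graded case -/

/-- `A = ⨁ n, 𝒜 n` is a standard graded algebra over the field `k`: `A₀ = k`, and `A` is generated
as a `k`-algebra by `A₁`, which has finite dimension over `k`. -/
structure IsStandardGraded {k : Type w} [Field k] {A : Type u} [CommRing A] [Algebra k A]
    (𝒜 : ℕ → Submodule k A) [GradedAlgebra 𝒜] : Prop where
  nontrivial : Nontrivial A
  zero_eq : 𝒜 0 = LinearMap.range (Algebra.linearMap k A)
  finite_one : Module.Finite k (𝒜 1)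
  adjoin_one : Algebra.adjoin k (𝒜 1 : Set A) = ⊤

/-- `M = ⨁ n, ℳ n` is a `ℤ`-graded module over the graded ring `A = ⨁ n, 𝒜 n`. -/
structure IsGradedModule {k : Type w} [Field k] {A : Type u} [CommRing A] [Algebra k A]
    (𝒜 : ℕ → Submodule k A) {M : Type v} [AddCommGroup M] [Module A M]
    (ℳ : ℤ → AddSubgroup M) : Prop where
  isInternal : DirectSum.IsInternal ℳ
  smul_mem : ∀ (i : ℕ) (j : ℤ) (a : A) (x : M), a ∈ 𝒜 i → x ∈ ℳ j → a • x ∈ ℳ (i + j)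

/-- The homogeneous component of `A` of degree `n`, for an integer `n`; it is `0` for `n < 0`. -/
def intPiece {k : Type w} [Field k] {A : Type u} [CommRing A] [Algebra k A]
    (𝒜 : ℕ → Submodule k A) : ℤ → Submodule k A
  | Int.ofNat n => 𝒜 n
  | Int.negSucc _ => ⊥

/-- A minimal free resolution is graded if, for suitable integers `a i j`, its augmentation and its
differentials are homogeneous of degree `0` when `F i` is the graded module `⨁ j, A(- a i j)`, that
is, when the `j`-th basis vector of `F i` has degree `a i j`. -/
def MinimalFreeResolution.IsGraded {k : Type w} [Field k] {A : Type u} [CommRing A] [Algebra k A]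
    (𝒜 : ℕ → Submodule k A) {M : Type v} [AddCommGroup M] [Module A M]
    (ℳ : ℤ → AddSubgroup M) {m : Ideal A} (F : MinimalFreeResolution m M) : Prop :=
  ∃ a : ∀ i : ℕ, Fin (F.rank i) → ℤ,
    (∀ j, F.ε (Pi.single j 1) ∈ ℳ (a 0 j)) ∧
    ∀ i j l, F.d i (Pi.single j 1) l ∈ intPiece 𝒜 (a (i + 1) j - a i l)

/-- The linearity defect of a finitely generated graded module over a standard graded algebra:
`sup {i : H_i (lin F) ≠ 0}` for the minimal graded free resolution `F` of `M`. The latter exists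
and is unique up to isomorphism, so that the outer supremum is that of a constant family. -/
def gradedLind {k : Type w} [Field k] {A : Type u} [CommRing A] [Algebra k A]
    (𝒜 : ℕ → Submodule k A) [GradedAlgebra 𝒜] {M : Type v} [AddCommGroup M] [Module A M]
    (ℳ : ℤ → AddSubgroup M) : ℕ∞ :=
  ⨆ F : {F : MinimalFreeResolution (HomogeneousIdeal.irrelevant 𝒜).toIdeal M // F.IsGraded 𝒜 ℳ},
    F.1.linDefect

end

/-! The linearity defect of `M` is at most `d` if and only if the natural maps
`Tor_(n + 1) (R / m ^ (q + 1), M) → Tor_(n + 1) (R / m ^ q, M)` vanish for all `n ≥ d` and all `q`: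
for the minimal resolution `F`, such a map is zero if and only if every `x ∈ F (n + 1)` with
`∂ x ∈ m ^ (q + 1) F n` is congruent modulo `m ^ q F (n + 1)` to a boundary, and these conditions
amount to the exactness of `lin F` in homological degrees above `d`.

Let `0 → M → P → N → 0` be exact and `I ≤ L ≤ J`. In the map of long exact sequences, if
`Tor (R / L, -) → Tor (R / J, -)` vanishes on one neighbour of a module and
`Tor (R / I, -) → Tor (R / L, -)` on the other, then `Tor (R / I, -) → Tor (R / J, -)` vanishes on
the module itself. With `I = m ^ (q + 1)`, `J = m ^ q` and `L` one of them, the linearity defect of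
one neighbour controls one factor; the other factor is the identity of a Tor group of the other
neighbour, which vanishes above its projective dimension. -/

section ShortExact

variable {R : Type u} [CommRing R]
  {A B K F G M P N : Type u} [AddCommGroup A] [Module R A] [AddCommGroup B] [Module R B]
  [AddCommGroup K] [Module R K] [AddCommGroup F] [Module R F] [AddCommGroup G] [Module R G]
  [AddCommGroup M] [Module R M] [AddCommGroup P] [Module R P] [AddCommGroup N] [Module R N]

/-- The sequence `0 → K → F → M → 0` with the maps `i` and `p` is exact. -/
structure IsShortExact (i : K →ₗ[R] F) (p : F →ₗ[R] M) : Prop where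
  injective : Function.Injective i
  exact : Function.Exact i p
  surjective : Function.Surjective p

namespace IsShortExact

variable {i : K →ₗ[R] F} {p : F →ₗ[R] M}

theorem subtype_ker {f : F →ₗ[R] M} (hf : Function.Surjective f) :
    IsShortExact (LinearMap.ker f).subtype f :=
  ⟨Subtype.val_injective, LinearMap.exact_subtype_ker_map f, hf⟩

theorem subtype_range_rangeRestrict {f : K →ₗ[R] F} {g : F →ₗ[R] M} (h : Function.Exact f g) :
    IsShortExact (LinearMap.range f).subtype g.rangeRestrict :=
  ⟨Subtype.val_injective, fun x => by simpa [Subtype.ext_iff] using h x,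
    g.surjective_rangeRestrict⟩

theorem exists_lift (h : IsShortExact i p) (f : G →ₗ[R] F) (hf : ∀ x, p (f x) = 0) :
    ∃ g : G →ₗ[R] K, ∀ x, i (g x) = f x := by
  have hmem : ∀ x, f x ∈ LinearMap.range i := fun x => (h.exact (f x)).1 (hf x)
  refine ⟨(LinearEquiv.ofInjective i h.injective).symm.toLinearMap ∘ₗ f.codRestrict _ hmem,
    fun x => ?_⟩
  exact congrArg Subtype.val
    ((LinearEquiv.ofInjective i h.injective).apply_symm_apply ⟨f x, hmem x⟩)

theorem exists_section [Module.Projective R M] (h : IsShortExact i p) :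
    ∃ σ : M →ₗ[R] F, ∀ x, p (σ x) = x := by
  obtain ⟨σ, hσ⟩ := Module.projective_lifting_property p LinearMap.id h.surjective
  exact ⟨σ, LinearMap.congr_fun hσ⟩

theorem exists_retraction [Module.Projective R M] (h : IsShortExact i p) :
    ∃ r : F →ₗ[R] K, ∀ x, r (i x) = x := by
  obtain ⟨σ, hσ⟩ := h.exists_section
  obtain ⟨r, hr⟩ := h.exists_lift (LinearMap.id - σ ∘ₗ p) fun x => by simp [hσ]
  exact ⟨r, fun x => h.injective (by simp [hr, h.exact.apply_apply_eq_zero])⟩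

theorem subtype_ker_comp {φ : M →ₗ[R] P} {ψ : P →ₗ[R] N} {a : A →ₗ[R] B} {q : B →ₗ[R] P}
    (h : IsShortExact φ ψ) (hq : IsShortExact a q) :
    IsShortExact (LinearMap.ker (ψ ∘ₗ q)).subtype (ψ ∘ₗ q) :=
  .subtype_ker (h.surjective.comp hq.surjective)

theorem exists_ker_comp {φ : M →ₗ[R] P} {ψ : P →ₗ[R] N} {a : A →ₗ[R] B} {q : B →ₗ[R] P}
    (h : IsShortExact φ ψ) (hq : IsShortExact a q) :
    ∃ (j : A →ₗ[R] LinearMap.ker (ψ ∘ₗ q)) (π : LinearMap.ker (ψ ∘ₗ q) →ₗ[R] M),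
      IsShortExact j π ∧ ∀ x, (j x : B) = a x := by
  obtain ⟨π, hπ⟩ := h.exists_lift (q ∘ₗ (LinearMap.ker (ψ ∘ₗ q)).subtype) fun x => x.2
  have hπ' : ∀ x, φ (π x) = q x := hπ
  refine ⟨a.codRestrict _ fun x => by simp [hq.exact.apply_apply_eq_zero], π,
    ⟨fun x y hxy => hq.injective (congrArg Subtype.val hxy), fun x => ?_, fun y => ?_⟩,
    fun _ => rfl⟩
  · rw [← h.injective.eq_iff, hπ', map_zero, hq.exact]
    simp [Subtype.ext_iff]
  · obtain ⟨b, hb⟩ := hq.surjective (φ y)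
    refine ⟨⟨b, by simp [hb, h.exact.apply_apply_eq_zero]⟩, h.injective ?_⟩
    rw [hπ', hb]

theorem exists_prod_coprod [Module.Projective R G] {φ : M →ₗ[R] P} {ψ : P →ₗ[R] N} {i : K →ₗ[R] G}
    {s : G →ₗ[R] N} (h : IsShortExact φ ψ) (hs : IsShortExact i s) :
    ∃ (ρ : K →ₗ[R] M) (τ : G →ₗ[R] P), IsShortExact (ρ.prod i) (φ.coprod τ) := by
  obtain ⟨τ, hτ⟩ := Module.projective_lifting_property ψ s h.surjective
  replace hτ : ∀ g, ψ (τ g) = s g := LinearMap.congr_fun hτ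
  obtain ⟨ρ, hρ⟩ := h.exists_lift (-(τ ∘ₗ i)) fun x => by
    simp [hτ, hs.exact.apply_apply_eq_zero]
  refine ⟨ρ, τ, ⟨fun x y hxy => hs.injective (congrArg Prod.snd hxy), ?_, fun y => ?_⟩⟩
  · rintro ⟨x, g⟩
    constructor
    · intro (hxg : φ x + τ g = 0)
      have hg : s g = 0 := by
        simpa [hτ, h.exact.apply_apply_eq_zero] using congrArg ψ hxg
      obtain ⟨z, rfl⟩ := (hs.exact g).1 hg
      have hz : ρ z = x := h.injective <| by
        rw [hρ]; exact (eq_neg_of_add_eq_zero_left hxg).symm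
      exact ⟨z, Prod.ext hz rfl⟩
    · rintro ⟨z, rfl, rfl⟩
      simp [hρ]
  · obtain ⟨g, hg⟩ := hs.surjective (ψ y)
    obtain ⟨x, hx⟩ := (h.exact (y - τ g)).1 (by simp [hτ, hg])
    exact ⟨(x, g), by simp [hx]⟩

variable (G) in
theorem prodMap_id (h : IsShortExact i p) :
    IsShortExact (LinearMap.inl R F G ∘ₗ i) (p.prodMap LinearMap.id) where
  injective := LinearMap.inl_injective.comp h.injective
  exact := by
    rintro ⟨x, g⟩
    simp [Prod.ext_iff, h.exact x, @eq_comm G 0]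
  surjective := h.surjective.prodMap Function.surjective_id

end IsShortExact

end ShortExact

section Tor

variable {R : Type u} [CommRing R]

/-- For ideals `I ≤ J`, the map `Tor_(n + 1) (R / I, M) → Tor_(n + 1) (R / J, M)` is zero. This is
expressed by dimension shifting: `Tor_1 (R / I, M) = (K ∩ I F) / I K` for a short exact sequence
`0 → K → F → M → 0` with `F` projective, and `Tor_(n + 2) (R / I, M) = Tor_(n + 1) (R / I, K)`. For
`n = 0` the condition on projective `F` implies the one on arbitrary `F`. -/
def TorMapVanishes (I J : Ideal R) : ℕ → ∀ (M : Type u) [AddCommGroup M] [Module R M], Prop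
  | 0, M, _, _ => ∀ (K F : Type u) [AddCommGroup K] [Module R K] [AddCommGroup F] [Module R F]
      (i : K →ₗ[R] F) (p : F →ₗ[R] M), IsShortExact i p →
        (I • (⊤ : Submodule R F)).comap i ≤ J • ⊤
  | n + 1, M, _, _ => ∀ (K F : Type u) [AddCommGroup K] [Module R K] [AddCommGroup F] [Module R F]
      [Module.Projective R F] (i : K →ₗ[R] F) (p : F →ₗ[R] M), IsShortExact i p →
        TorMapVanishes I J n K

variable (R) in
theorem exists_isShortExact_projective (M : Type u) [AddCommGroup M] [Module R M] :
    ∃ (K F : Type u) (_ : AddCommGroup K) (_ : Module R K) (_ : AddCommGroup F) (_ : Module R F)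
      (_ : Module.Projective R F) (i : K →ₗ[R] F) (p : F →ₗ[R] M), IsShortExact i p :=
  ⟨_, M →₀ R, inferInstance, inferInstance, inferInstance, inferInstance, inferInstance, _, _,
    .subtype_ker (Finsupp.linearCombination_id_surjective R M)⟩

namespace TorMapVanishes

variable {I J L : Ideal R} {n : ℕ}
  {K F G M P N : Type u} [AddCommGroup K] [Module R K] [AddCommGroup F] [Module R F]
  [AddCommGroup G] [Module R G] [AddCommGroup M] [Module R M] [AddCommGroup P] [Module R P]
  [AddCommGroup N] [Module R N]

theorem zero_of_projective_cover [Module.Projective R F] {i : K →ₗ[R] F} {p : F →ₗ[R] M}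
    (hIJ : I ≤ J) (h : IsShortExact i p) (hK : (I • (⊤ : Submodule R F)).comap i ≤ J • ⊤) :
    TorMapVanishes I J 0 M := by
  intro K' F' _ _ _ _ i' p' h' z hz
  obtain ⟨σ, hσ⟩ := Module.projective_lifting_property p' p h'.surjective
  replace hσ : ∀ x, p' (σ x) = p x := LinearMap.congr_fun hσ
  obtain ⟨τ, hτ⟩ := h'.exists_lift (σ ∘ₗ i) fun x => by simp [hσ, h.exact.apply_apply_eq_zero]
  have hsup : LinearMap.range i' ⊔ LinearMap.range σ = ⊤ := by
    refine eq_top_iff.2 fun y _ => ?_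
    obtain ⟨x, hx⟩ := h.surjective (p' y)
    obtain ⟨w, hw⟩ := (h'.exact (y - σ x)).1 (by simp [hσ, hx])
    exact Submodule.mem_sup.2 ⟨i' w, ⟨w, rfl⟩, σ x, ⟨x, rfl⟩, by simp [hw]⟩
  have hz' : i' z ∈ (I • ⊤ : Submodule R K').map i' ⊔ (I • ⊤ : Submodule R F).map σ := by
    rwa [Submodule.map_smul'', Submodule.map_smul'', Submodule.map_top, Submodule.map_top,
      ← Submodule.smul_sup, hsup]
  obtain ⟨_, ⟨y, hy, rfl⟩, _, ⟨x, hx, rfl⟩, hyx⟩ := Submodule.mem_sup.1 hz'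
  obtain ⟨w, rfl⟩ := (h.exact x).1 <| by
    simpa [hσ, h'.exact.apply_apply_eq_zero] using congrArg p' hyx
  have hzw : z = y + τ w := h'.injective (by simp [hτ, ← hyx])
  have hw : τ w ∈ J • (⊤ : Submodule R K') :=
    Submodule.smul_top_le_comap_smul_top J τ (hK hx)
  exact hzw ▸ add_mem (Submodule.smul_mono_left hIJ hy) hw

theorem zero_iff [Module.Projective R F] {i : K →ₗ[R] F} {p : F →ₗ[R] M} (hIJ : I ≤ J)
    (h : IsShortExact i p) :
    TorMapVanishes I J 0 M ↔ (I • (⊤ : Submodule R F)).comap i ≤ J • ⊤ :=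
  ⟨fun hM => hM K F i p h, zero_of_projective_cover hIJ h⟩

theorem of_projective [Module.Projective R M] (hIJ : I ≤ J) : TorMapVanishes I J n M := by
  induction n generalizing M with
  | zero =>
    intro K F _ _ _ _ i p h x hx
    obtain ⟨r, hr⟩ := h.exists_retraction
    have := Submodule.smul_top_le_comap_smul_top I r hx
    rw [Submodule.mem_comap, hr] at this
    exact Submodule.smul_mono_left hIJ this
  | succ n ih =>
    intro K F _ _ _ _ _ i p h
    obtain ⟨r, hr⟩ := h.exists_retraction
    have : Module.Projective R K := Module.Projective.of_split i r (LinearMap.ext hr)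
    exact ih

theorem of_prod [Module.Projective R G] (h : TorMapVanishes I J n (M × G)) :
    TorMapVanishes I J n M := by
  cases n with
  | zero =>
    intro K F _ _ _ _ i p hp x hx
    exact h K (F × G) _ _ (hp.prodMap_id G)
      (Submodule.smul_top_le_comap_smul_top I (LinearMap.inl R F G) hx)
  | succ n => exact fun K F _ _ _ _ _ i p hp => h K (F × G) _ _ (hp.prodMap_id G)

theorem middle {φ : M →ₗ[R] P} {ψ : P →ₗ[R] N} (h : IsShortExact φ ψ)
    (hM : TorMapVanishes L J n M) (hN : TorMapVanishes I L n N) : TorMapVanishes I J n P := by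
  induction n generalizing M P N with
  | zero =>
    intro A B _ _ _ _ a q hq x hx
    obtain ⟨j, π, hj, hja⟩ := h.exists_ker_comp hq
    refine hM _ _ j π hj (hN _ _ _ _ (h.subtype_ker_comp hq) ?_)
    simpa [hja] using hx
  | succ n ih =>
    intro A B _ _ _ _ _ a q hq
    obtain ⟨j, π, hj, -⟩ := h.exists_ker_comp hq
    obtain ⟨K, F, _, _, _, _, _, i, s, hs⟩ := exists_isShortExact_projective R M
    obtain ⟨ρ, τ, hρτ⟩ := hj.exists_prod_coprod hs
    have hker := hN _ _ _ _ (h.subtype_ker_comp hq)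
    exact of_prod (ih hρτ (hM _ _ _ _ hs) hker)

theorem left {φ : M →ₗ[R] P} {ψ : P →ₗ[R] N} (h : IsShortExact φ ψ)
    (hP : TorMapVanishes I L n P) (hN : TorMapVanishes L J (n + 1) N) :
    TorMapVanishes I J n M := by
  obtain ⟨K, F, _, _, _, _, _, i, s, hs⟩ := exists_isShortExact_projective R N
  obtain ⟨ρ, τ, hρτ⟩ := h.exists_prod_coprod hs
  exact of_prod (middle hρτ (hN _ _ _ _ hs) hP)

theorem succ_iff [Module.Projective R F] {i : K →ₗ[R] F} {p : F →ₗ[R] M} (h : IsShortExact i p) :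
    TorMapVanishes I J (n + 1) M ↔ TorMapVanishes I J n K := by
  refine ⟨fun hM => hM K F i p h, fun hK K' F' _ _ _ _ _ i' p' h' => ?_⟩
  obtain ⟨ρ, τ, hρτ⟩ := h'.exists_prod_coprod h
  exact of_prod (middle hρτ hK (of_projective le_rfl))

theorem right {φ : M →ₗ[R] P} {ψ : P →ₗ[R] N} (h : IsShortExact φ ψ)
    (hM : TorMapVanishes I L n M) (hP : TorMapVanishes L J (n + 1) P) :
    TorMapVanishes I J (n + 1) N := by
  obtain ⟨K, F, _, _, _, _, _, i, q, hq⟩ := exists_isShortExact_projective R P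
  obtain ⟨j, π, hj, -⟩ := h.exists_ker_comp hq
  exact (succ_iff (h.subtype_ker_comp hq)).2 (middle hj (hP _ _ _ _ hq) hM)

theorem of_hasProjectiveDimensionLE (hIJ : I ≤ J)
    (hM : CategoryTheory.HasProjectiveDimensionLE (ModuleCat.of R M) n) :
    TorMapVanishes I J n M := by
  induction n generalizing M with
  | zero =>
    have : Module.Projective R M := (IsProjective.iff_projective M).2
      (CategoryTheory.projective_iff_hasProjectiveDimensionLE_zero _ |>.2 hM)
    exact of_projective hIJ
  | succ n ih =>
    obtain ⟨K, F, _, _, _, _, _, i, p, h⟩ := exists_isShortExact_projective R M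
    have hF := (IsProjective.iff_projective F).1 ‹_›
    exact (succ_iff (.subtype_ker h.surjective)).2 <| ih <|
      ((LinearMap.shortExact_shortComplexKer h.surjective).hasProjectiveDimensionLT_X₃_iff n hF).1
        hM

theorem of_projdim_le {d : ℕ} (hIJ : I ≤ J) (hM : projdim R M ≤ d) (hn : d ≤ n) :
    TorMapVanishes I J n M :=
  of_hasProjectiveDimensionLE hIJ <| (CategoryTheory.projectiveDimension_le_iff _ _).1 <|
    hM.trans (mod_cast hn)

end TorMapVanishes

end Tor

namespace MinimalFreeResolution

section LinearPart

variable {R : Type u} [CommRing R] {m : Ideal R} {M : Type v} [AddCommGroup M] [Module R M]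
  (F : MinimalFreeResolution m M)

theorem subsingleton_linHomology_succ_iff (n j : ℕ) :
    Subsingleton (F.linHomology n (j + 1)) ↔
      ∀ x ∈ F.filtration n (j + 1), F.d j x ∈ F.filtration (n + 1) j →
        x ∈ F.filtration (n + 1) (j + 1) ⊔ (F.filtration n (j + 2)).map (F.d (j + 1)) := by
  have h : Subsingleton (F.linHomology n (j + 1)) ↔
      F.linCycles n (j + 1) ≤ F.linBoundaries n (j + 1) :=
    Submodule.Quotient.subsingleton_iff.trans Submodule.comap_subtype_eq_top
  rw [h]
  constructor
  · intro h x hx hdx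
    obtain ⟨y, hy⟩ := h (x := Submodule.Quotient.mk ⟨x, hx⟩)
      ((Submodule.Quotient.mk_eq_zero _).2 hdx)
    obtain ⟨⟨y, hy'⟩, rfl⟩ := Submodule.Quotient.mk_surjective _ y
    have hxy : x - F.d (j + 1) y ∈ F.filtration (n + 1) (j + 1) := (Submodule.Quotient.eq
      ((F.filtration (n + 1) (j + 1)).submoduleOf (F.filtration n (j + 1)))).1 hy.symm
    exact Submodule.mem_sup.2 ⟨_, hxy, _, ⟨y, hy', rfl⟩, sub_add_cancel _ _⟩
  · rintro h x hx
    obtain ⟨⟨x, hx'⟩, rfl⟩ := Submodule.Quotient.mk_surjective _ x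
    obtain ⟨z, hz, _, ⟨y, hy, rfl⟩, hzy⟩ := Submodule.mem_sup.1 <| h x hx' <|
      (Submodule.Quotient.mk_eq_zero
        ((F.filtration (n + 1) j).submoduleOf (F.filtration n j))).1 hx
    refine ⟨Submodule.Quotient.mk ⟨y, hy⟩, ((Submodule.Quotient.eq
      ((F.filtration (n + 1) (j + 1)).submoduleOf (F.filtration n (j + 1)))).2 ?_).symm⟩
    change x - F.d (j + 1) y ∈ F.filtration (n + 1) (j + 1)
    rwa [← eq_sub_of_add_eq hzy]

theorem linDefect_le_iff_linHomology (d : ℕ) :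
    F.linDefect ≤ d ↔ ∀ j ≥ d, ∀ n, Subsingleton (F.linHomology n (j + 1)) := by
  simp only [linDefect, iSup_le_iff, Set.mem_ofPred_eq, Nat.cast_le, forall_exists_index,
    ← not_subsingleton_iff_nontrivial]
  constructor
  · intro h j hj n
    by_contra hn
    exact absurd (h (j + 1) n hn) (by omega)
  · rintro h i n hn
    by_contra! hi
    obtain ⟨j, rfl⟩ := Nat.exists_eq_add_of_lt hi
    exact hn (h (d + j) (by omega) n)

/-- One step `s ↦ s + 1` of the approximation of `x` by boundaries is exactness of `lin F` in
homological degree `j + 1` and internal degree `j + 1 + s`. -/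
theorem comap_d_le_of_subsingleton_linHomology {j : ℕ}
    (h : ∀ n, Subsingleton (F.linHomology n (j + 1))) (q : ℕ) :
    (m ^ (q + 1) • ⊤ : Submodule R _).comap (F.d j) ≤
      m ^ q • ⊤ ⊔ LinearMap.range (F.d (j + 1)) := by
  intro x hx
  suffices ∀ s ≤ q, x ∈ m ^ s • ⊤ ⊔ LinearMap.range (F.d (j + 1)) from this q le_rfl
  intro s
  induction s with
  | zero => simp only [pow_zero, Ideal.one_eq_top, Submodule.top_smul, top_sup_eq,
      Submodule.mem_top, implies_true]
  | succ s ih =>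
    intro hs
    obtain ⟨z, hz, _, ⟨y, rfl⟩, rfl⟩ := Submodule.mem_sup.1 (ih (by omega))
    have hdz : F.d j z ∈ m ^ (s + 2) • (⊤ : Submodule R _) := by
      rw [Submodule.mem_comap, map_add, (F.exact_succ j).apply_apply_eq_zero, add_zero] at hx
      exact Submodule.smul_mono_left (Ideal.pow_le_pow_right (by omega)) hx
    have := (F.subsingleton_linHomology_succ_iff (j + 1 + s) j).1 (h _) z
    simp only [filtration, show j + 1 + s - (j + 1) = s by omega,
      show j + 1 + s + 1 - j = s + 2 by omega,
      show j + 1 + s + 1 - (j + 1) = s + 1 by omega] at this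
    have hz' := sup_le_sup_left (LinearMap.map_le_range (f := F.d (j + 1))) _ (this hz hdz)
    exact add_mem hz' (Submodule.mem_sup_right ⟨y, rfl⟩)

theorem subsingleton_linHomology_of_comap_d_le {d : ℕ}
    (h : ∀ j ≥ d, ∀ q, (m ^ (q + 1) • ⊤ : Submodule R _).comap (F.d j) ≤
      m ^ q • ⊤ ⊔ LinearMap.range (F.d (j + 1))) {j : ℕ} (hj : d ≤ j) (n : ℕ) :
    Subsingleton (F.linHomology n (j + 1)) := by
  rw [subsingleton_linHomology_succ_iff]
  intro x hx hdx
  obtain hn | hn := le_or_gt n j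
  · simp only [filtration, Nat.sub_eq_zero_of_le (Nat.add_le_add_right hn 1), pow_zero,
      Ideal.one_eq_top, Submodule.top_smul, top_sup_eq, Submodule.mem_top]
  obtain ⟨s, rfl⟩ := Nat.exists_eq_add_of_le (Nat.succ_le_of_lt hn)
  simp only [filtration, show j.succ + s - (j + 1) = s by omega,
    show j.succ + s + 1 - j = s + 1 + 1 by omega,
    show j.succ + s + 1 - (j + 1) = s + 1 by omega,
    show j.succ + s - (j + 2) = s - 1 by omega] at hx hdx ⊢
  obtain ⟨z, hz, _, ⟨y, rfl⟩, rfl⟩ := Submodule.mem_sup.1 (h j hj (s + 1) hdx)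
  refine add_mem (Submodule.mem_sup_left hz) (Submodule.mem_sup_right ?_)
  cases s with
  | zero => exact ⟨y, by simp only [pow_zero, Ideal.one_eq_top, Submodule.top_smul,
      Submodule.mem_top, SetLike.mem_coe, Nat.zero_sub], rfl⟩
  | succ s =>
    have hdy : F.d (j + 1) y ∈ m ^ (s + 1) • (⊤ : Submodule R _) :=
      (add_mem_cancel_left (Submodule.smul_mono_left (Ideal.pow_le_pow_right (by omega)) hz)).1 hx
    obtain ⟨w, hw, v, hv, rfl⟩ := Submodule.mem_sup.1 (h (j + 1) (by omega) s hdy)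
    refine ⟨w, hw, ?_⟩
    rw [map_add, (F.exact_succ (j + 1)).linearMap_ker_eq.ge hv, add_zero]

theorem linDefect_le_iff_comap_d_le (d : ℕ) :
    F.linDefect ≤ d ↔ ∀ j ≥ d, ∀ q, (m ^ (q + 1) • ⊤ : Submodule R _).comap (F.d j) ≤
      m ^ q • ⊤ ⊔ LinearMap.range (F.d (j + 1)) := by
  rw [linDefect_le_iff_linHomology]
  exact ⟨fun h j hj => F.comap_d_le_of_subsingleton_linHomology (h j hj),
    fun h j hj => F.subsingleton_linHomology_of_comap_d_le h hj⟩

end LinearPart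

section Tor

variable {R : Type u} [CommRing R] {m : Ideal R}

theorem torMapVanishes_iff_comap_d_le {M : Type v} [AddCommGroup M] [Module R M]
    (F : MinimalFreeResolution m M) {I J : Ideal R} (hIJ : I ≤ J) {i n : ℕ} {X : Type u}
    [AddCommGroup X] [Module R X] {p : (Fin (F.rank i) → R) →ₗ[R] X}
    (hp : IsShortExact (LinearMap.range (F.d i)).subtype p) :
    TorMapVanishes I J n X ↔ (I • ⊤ : Submodule R _).comap (F.d (i + n)) ≤
      J • ⊤ ⊔ LinearMap.range (F.d (i + n + 1)) := by
  induction n generalizing i X with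
  | zero =>
    let s := (F.d i).rangeRestrict
    have hJ : (J • ⊤ : Submodule R _).comap s = J • ⊤ ⊔ LinearMap.range (F.d (i + 1)) := by
      rw [← (F.exact_succ i).linearMap_ker_eq, ← LinearMap.ker_rangeRestrict,
        ← Submodule.comap_map_eq, Submodule.map_smul'', Submodule.map_top,
        LinearMap.range_rangeRestrict]
    rw [TorMapVanishes.zero_iff hIJ hp, add_zero, ← hJ,
      ← Submodule.comap_le_comap_iff_of_surjective (F.d i).surjective_rangeRestrict]
    rfl
  | succ n ih =>
    rw [TorMapVanishes.succ_iff hp, ih (.subtype_range_rangeRestrict (F.exact_succ i)),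
      show i + 1 + n = i + (n + 1) by omega]

theorem linDefect_le_iff {M : Type u} [AddCommGroup M] [Module R M]
    (F : MinimalFreeResolution m M) (d : ℕ) :
    F.linDefect ≤ d ↔ ∀ n ≥ d, ∀ q, TorMapVanishes (m ^ (q + 1)) (m ^ q) n M := by
  have hε : IsShortExact (LinearMap.range (F.d 0)).subtype F.ε :=
    ⟨Subtype.val_injective, fun x => by simpa using F.exact_zero x, F.ε_surjective⟩
  rw [linDefect_le_iff_comap_d_le]
  refine forall₃_congr fun n _ q => ?_
  rw [F.torMapVanishes_iff_comap_d_le (Ideal.pow_le_pow_right q.le_succ) hε, zero_add]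

end Tor

end MinimalFreeResolution

section LinearityDefect

variable {R : Type u} [CommRing R] {m : Ideal R} {M : Type u} [AddCommGroup M] [Module R M]

/-- The linearity defect of `M` with respect to an ideal `m`, of which `lind` and `gradedLind` are
instances. All minimal free resolutions of `M` have the same linearity defect; if there is none, the
value is `0`. -/
noncomputable def linearityDefect (m : Ideal R) (M : Type u) [AddCommGroup M] [Module R M] : ℕ∞ :=
  ⨆ F : MinimalFreeResolution m M, F.linDefect

theorem linearityDefect_le_of_torMapVanishes {d : ℕ}
    (h : ∀ n ≥ d, ∀ q, TorMapVanishes (m ^ (q + 1)) (m ^ q) n M) : linearityDefect m M ≤ d :=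
  iSup_le fun F => (F.linDefect_le_iff d).2 h

theorem torMapVanishes_of_linearityDefect_le [Nonempty (MinimalFreeResolution m M)] {d n : ℕ}
    (h : linearityDefect m M ≤ d) (hn : d ≤ n) (q : ℕ) :
    TorMapVanishes (m ^ (q + 1)) (m ^ q) n M :=
  let F := Classical.arbitrary (MinimalFreeResolution m M)
  (F.linDefect_le_iff d).1 ((le_iSup MinimalFreeResolution.linDefect F).trans h) n hn q

theorem MinimalFreeResolution.linDefect_eq_linearityDefect (F : MinimalFreeResolution m M) :
    F.linDefect = linearityDefect m M := by
  refine (le_iSup linDefect F).antisymm ?_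
  cases h : F.linDefect with
  | top => exact le_top
  | coe d => exact linearityDefect_le_of_torMapVanishes ((F.linDefect_le_iff d).1 h.le)

theorem lind_eq_linearityDefect [IsLocalRing R] :
    lind R M = linearityDefect (IsLocalRing.maximalIdeal R) M :=
  rfl

theorem coe_le_max_of_forall_natCast {a b : ℕ∞} {x : WithBot ℕ∞}
    (h : ∀ d : ℕ, x ≤ d → b ≤ d → a ≤ d) : (a : WithBot ℕ∞) ≤ max x b := by
  obtain ⟨y, hy⟩ : ∃ y : ℕ∞, max x b = y := by
    cases x with
    | bot => exact ⟨b, bot_sup_eq _⟩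
    | coe x => exact ⟨max x b, rfl⟩
  obtain ⟨hx, hb⟩ := max_le_iff.1 hy.le
  rw [hy, WithBot.coe_le_coe]
  cases y with
  | top => exact le_top
  | coe d => exact h d hx (WithBot.coe_le_coe.1 hb)

end LinearityDefect

namespace IsShortExact

variable {R : Type u} [CommRing R] {M P N : Type u}
  [AddCommGroup M] [Module R M] [AddCommGroup P] [Module R P] [AddCommGroup N] [Module R N]
  {φ : M →ₗ[R] P} {ψ : P →ₗ[R] N}

variable (m : Ideal R)

theorem linearityDefect_right_le_max_projdim_middle [Nonempty (MinimalFreeResolution m M)]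
    (h : IsShortExact φ ψ) :
    (linearityDefect m N : WithBot ℕ∞) ≤
      max (projdim R P) ((linearityDefect m M + 1 : ℕ∞) : WithBot ℕ∞) := by
  refine coe_le_max_of_forall_natCast fun d hP hM =>
    linearityDefect_le_of_torMapVanishes fun n hn q => ?_
  obtain _ | d := d
  · simp at hM
  obtain ⟨n, rfl⟩ := Nat.exists_eq_add_of_le' (Nat.one_le_of_lt hn)
  have hM' : linearityDefect m M ≤ d := by simpa using hM
  exact .right h (torMapVanishes_of_linearityDefect_le hM' (by omega) q)
    (.of_projdim_le le_rfl hP hn)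

theorem linearityDefect_right_le_max_projdim_left [Nontrivial M]
    [Nonempty (MinimalFreeResolution m P)] (h : IsShortExact φ ψ) :
    (linearityDefect m N : WithBot ℕ∞) ≤ max (projdim R M + 1) (linearityDefect m P) := by
  refine coe_le_max_of_forall_natCast fun d hM hP =>
    linearityDefect_le_of_torMapVanishes fun n hn q => ?_
  obtain _ | d := d
  · rw [Nat.cast_zero, ENat.WithBot.add_one_le_zero_iff,
      CategoryTheory.projectiveDimension_eq_bot_iff, ModuleCat.isZero_iff_subsingleton] at hM
    exact absurd hM (not_subsingleton M)
  obtain ⟨n, rfl⟩ := Nat.exists_eq_add_of_le' (Nat.one_le_of_lt hn)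
  have hM' : projdim R M ≤ d := ENat.WithBot.add_le_add_one_right_iff.1 hM
  exact .right h (.of_projdim_le le_rfl hM' (by omega))
    (torMapVanishes_of_linearityDefect_le hP hn q)

theorem linearityDefect_middle_le_max_projdim_left [Nonempty (MinimalFreeResolution m N)]
    (h : IsShortExact φ ψ) :
    (linearityDefect m P : WithBot ℕ∞) ≤ max (projdim R M) (linearityDefect m N) :=
  coe_le_max_of_forall_natCast fun _ hM hN => linearityDefect_le_of_torMapVanishes fun _ hn q =>
    .middle h (.of_projdim_le le_rfl hM hn) (torMapVanishes_of_linearityDefect_le hN hn q)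

theorem linearityDefect_middle_le_max_projdim_right [Nonempty (MinimalFreeResolution m M)]
    (h : IsShortExact φ ψ) :
    (linearityDefect m P : WithBot ℕ∞) ≤ max (projdim R N) (linearityDefect m M) :=
  coe_le_max_of_forall_natCast fun _ hN hM => linearityDefect_le_of_torMapVanishes fun _ hn q =>
    .middle h (torMapVanishes_of_linearityDefect_le hM hn q) (.of_projdim_le le_rfl hN hn)

theorem linearityDefect_left_le_max_projdim_middle [Nonempty (MinimalFreeResolution m N)]
    (h : IsShortExact φ ψ) :
    (linearityDefect m M : WithBot ℕ∞) ≤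
      max (projdim R P) ((linearityDefect m N - 1 : ℕ∞) : WithBot ℕ∞) := by
  refine coe_le_max_of_forall_natCast fun d hP hN =>
    linearityDefect_le_of_torMapVanishes fun n hn q => ?_
  have hN' : linearityDefect m N ≤ (d + 1 : ℕ) := mod_cast tsub_le_iff_right.1 hN
  exact .left h (.of_projdim_le le_rfl hP hn)
    (torMapVanishes_of_linearityDefect_le hN' (Nat.succ_le_succ hn) q)

theorem linearityDefect_left_le_max_projdim_right [Nonempty (MinimalFreeResolution m P)]
    (h : IsShortExact φ ψ) :
    (linearityDefect m M : WithBot ℕ∞) ≤ max (projdim R N) (linearityDefect m P) :=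
  coe_le_max_of_forall_natCast fun _ hN hP => linearityDefect_le_of_torMapVanishes fun _ hn q =>
    .left h (torMapVanishes_of_linearityDefect_le hP hn q)
      (.of_projdim_le le_rfl hN (by omega))

theorem linearityDefect_left_eq_sub_one [Nonempty (MinimalFreeResolution m M)]
    [Nonempty (MinimalFreeResolution m N)] [Module.Projective R P] (h : IsShortExact φ ψ) :
    linearityDefect m M = linearityDefect m N - 1 := by
  have hP (a : ℕ∞) : projdim R P ≤ a :=
    ((CategoryTheory.projectiveDimension_le_iff (ModuleCat.of R P) 0).2 <|
      (CategoryTheory.projective_iff_hasProjectiveDimensionLE_zero _).1 <|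
        (IsProjective.iff_projective P).1 inferInstance).trans (WithBot.coe_le_coe.2 bot_le)
  have hM := h.linearityDefect_left_le_max_projdim_middle m
  have hN := h.linearityDefect_right_le_max_projdim_middle m
  rw [max_eq_right (hP _), WithBot.coe_le_coe] at hM hN
  exact hM.antisymm (tsub_le_iff_right.2 hN)

end IsShortExact

theorem withBot_add_one_lt_top {x : WithBot ℕ∞} (hx : x < ⊤) : x + 1 < ⊤ := by
  cases x with
  | bot => exact hx
  | coe x =>
    exact WithBot.coe_lt_coe.2
      (WithTop.add_lt_top.2 ⟨WithBot.coe_lt_coe.1 hx, WithTop.one_lt_top⟩)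

section Existence

variable {R : Type u} [CommRing R] {m : Ideal R}

/-- The minimal free resolution obtained by iterating a choice of covers. A state `s : σ` stands for
a module of relations in `R ^ rank s`, which is the range of `d s`, and `next s` for the module of
relations between the columns of `d s`. -/
def MinimalFreeResolution.ofIterate {M : Type v} [AddCommGroup M] [Module R M] {σ : Type*}
    (rank : σ → ℕ) (next : σ → σ) (d : ∀ s, (Fin (rank (next s)) → R) →ₗ[R] (Fin (rank s) → R))
    (exact : ∀ s, Function.Exact (d (next s)) (d s))
    (minimal : ∀ s, LinearMap.range (d s) ≤ m • (⊤ : Submodule R (Fin (rank s) → R)))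
    {s₀ : σ} {ε : (Fin (rank s₀) → R) →ₗ[R] M} (ε_surjective : Function.Surjective ε)
    (exact_zero : Function.Exact (d s₀) ε) : MinimalFreeResolution m M where
  -- `Nat.rec` and not `next^[i] s₀`, so that `rank (i + 1)` unfolds to a `rank (next _)`
  rank i := rank (Nat.rec s₀ (fun _ => next) i)
  d _ := d _
  ε := ε
  ε_surjective := ε_surjective
  exact_zero := exact_zero
  exact_succ _ := exact _
  minimal _ := minimal _

theorem mem_smul_top_of_forall_mem {n : ℕ} {x : Fin n → R} (h : ∀ j, x j ∈ m) :
    x ∈ m • (⊤ : Submodule R (Fin n → R)) := by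
  rw [pi_eq_sum_univ' x]
  exact sum_mem fun j _ => Submodule.smul_mem_smul (h j) trivial

theorem span_range_comp_succAbove_of_isUnit {X : Type v} [AddCommGroup X] [Module R X] {n : ℕ}
    {g : Fin (n + 1) → X} {x : Fin (n + 1) → R} (hx : ∑ i, x i • g i = 0) {j : Fin (n + 1)}
    (hj : IsUnit (x j)) :
    Submodule.span R (Set.range (g ∘ j.succAbove)) = Submodule.span R (Set.range g) := by
  refine (Submodule.span_mono (Set.range_comp_subset_range _ _)).antisymm
    (Submodule.span_le.2 ?_)
  have hmem (i) : g (j.succAbove i) ∈ Submodule.span R (Set.range (g ∘ j.succAbove)) :=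
    Submodule.subset_span ⟨i, rfl⟩
  rintro _ ⟨i, rfl⟩
  obtain rfl | ⟨i, rfl⟩ := Fin.eq_self_or_eq_succAbove j i
  · rw [Fin.sum_univ_succAbove _ i] at hx
    rw [SetLike.mem_coe, ← Submodule.smul_mem_iff_of_isUnit _ hj, eq_neg_of_add_eq_zero_left hx]
    exact neg_mem (sum_mem fun l _ => Submodule.smul_mem _ _ (hmem l))
  · exact hmem i

theorem exists_range_eq_span_and_not_isUnit {X : Type v} [AddCommGroup X] [Module R X]
    {s : Set X} (hs : s.Finite) :
    ∃ (n : ℕ) (f : (Fin n → R) →ₗ[R] X), (∀ j, f (Pi.single j 1) ∈ s) ∧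
      LinearMap.range f = Submodule.span R s ∧ ∀ x ∈ LinearMap.ker f, ∀ j, ¬ IsUnit (x j) := by
  classical
  have hex : ∃ (n : ℕ) (g : Fin n → X), (∀ j, g j ∈ s) ∧
      Submodule.span R (Set.range g) = Submodule.span R s := by
    obtain ⟨n, g, -, rfl⟩ := hs.fin_param
    exact ⟨n, g, Set.mem_range_self, rfl⟩
  obtain ⟨g, hg, hspan⟩ := Nat.find_spec hex
  refine ⟨Nat.find hex, Fintype.linearCombination R g, fun j => ?_, ?_, fun x hx j hj => ?_⟩
  · simpa only [Fintype.linearCombination_apply_single, one_smul] using hg j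
  · rw [Fintype.range_linearCombination, hspan]
  rw [LinearMap.mem_ker, Fintype.linearCombination_apply] at hx
  have hmin := fun k hk => Nat.find_min hex (m := k) hk
  generalize Nat.find hex = n at *
  obtain _ | n := n
  · exact j.elim0
  · exact hmin n n.lt_succ_self ⟨g ∘ j.succAbove, fun i => hg _,
      (span_range_comp_succAbove_of_isUnit hx hj).trans hspan⟩

section Local

variable [IsLocalRing R]

theorem exists_range_eq_and_ker_le_of_fg {X : Type v} [AddCommGroup X] [Module R X]
    {K : Submodule R X} (hK : K.FG) :
    ∃ (n : ℕ) (f : (Fin n → R) →ₗ[R] X), LinearMap.range f = K ∧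
      LinearMap.ker f ≤ IsLocalRing.maximalIdeal R • ⊤ := by
  obtain ⟨s, rfl⟩ := hK
  obtain ⟨n, f, -, hrange, hker⟩ := exists_range_eq_span_and_not_isUnit (R := R) s.finite_toSet
  exact ⟨n, f, hrange, fun x hx => mem_smul_top_of_forall_mem (hker x hx)⟩

instance nonempty_minimalFreeResolution [IsNoetherianRing R] (M : Type v) [AddCommGroup M]
    [Module R M] [Module.Finite R M] :
    Nonempty (MinimalFreeResolution (IsLocalRing.maximalIdeal R) M) := by
  let σ := Σ n : ℕ, {K : Submodule R (Fin n → R) // K ≤ IsLocalRing.maximalIdeal R • ⊤}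
  have hcover (s : σ) : ∃ (t : σ) (f : (Fin t.1 → R) →ₗ[R] (Fin s.1 → R)),
      LinearMap.range f = s.2.1 ∧ LinearMap.ker f = t.2.1 := by
    obtain ⟨n, f, hrange, hker⟩ := exists_range_eq_and_ker_le_of_fg (IsNoetherian.noetherian s.2.1)
    exact ⟨⟨n, LinearMap.ker f, hker⟩, f, hrange, rfl⟩
  choose next d hrange hker using hcover
  obtain ⟨n, ε, hε, hεker⟩ :=
    exists_range_eq_and_ker_le_of_fg (Module.Finite.fg_top (R := R) (M := M))
  exact ⟨.ofIterate (fun s : σ => s.1) next d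
    (fun s => LinearMap.exact_iff.2 ((hker s).trans (hrange (next s)).symm))
    (fun s => (hrange s).trans_le s.2.2) (s₀ := ⟨n, LinearMap.ker ε, hεker⟩)
    (LinearMap.range_eq_top.1 hε) (LinearMap.exact_iff.2 (hrange _).symm)⟩

end Local

end Existence

section Graded

variable {k : Type w} [Field k] {A : Type u} [CommRing A] [Algebra k A]
  {𝒜 : ℕ → Submodule k A}

theorem IsGradedModule.intPiece_smul_mem {X : Type*} [AddCommGroup X] [Module A X]
    {𝒳 : ℤ → AddSubgroup X} (h𝒳 : IsGradedModule 𝒜 𝒳) {i j : ℤ} {a : A} {x : X}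
    (ha : a ∈ intPiece 𝒜 i) (hx : x ∈ 𝒳 j) : a • x ∈ 𝒳 (i + j) := by
  cases i with
  | ofNat n => exact h𝒳.smul_mem n j a x ha hx
  | negSucc n =>
    rw [(Submodule.mem_bot k).1 ha, zero_smul]
    exact zero_mem _

/-- The homogeneous component of degree `i` of the graded module `⨁ j, A(- b j)`. -/
def shiftedPiece (𝒜 : ℕ → Submodule k A) {n : ℕ} (b : Fin n → ℤ) (i : ℤ) :
    AddSubgroup (Fin n → A) :=
  .pi Set.univ fun j => (intPiece 𝒜 (i - b j)).toAddSubgroup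

theorem mem_shiftedPiece {n : ℕ} {b : Fin n → ℤ} {i : ℤ} {x : Fin n → A} :
    x ∈ shiftedPiece 𝒜 b i ↔ ∀ j, x j ∈ intPiece 𝒜 (i - b j) := by
  simp only [shiftedPiece, AddSubgroup.mem_pi, Set.mem_univ, true_imp_iff,
    Submodule.mem_toAddSubgroup]

theorem single_mem_shiftedPiece {n : ℕ} (b : Fin n → ℤ) (j : Fin n) {i : ℕ} {a : A}
    (ha : a ∈ 𝒜 i) : Pi.single j a ∈ shiftedPiece 𝒜 b (i + b j) := by
  refine mem_shiftedPiece.2 fun l => ?_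
  obtain rfl | hl := eq_or_ne l j
  · rwa [Pi.single_eq_same, add_sub_cancel_right]
  · rw [Pi.single_eq_of_ne hl]
    exact zero_mem _

theorem IsGradedModule.apply_mem_of_mem_shiftedPiece {X : Type*} [AddCommGroup X] [Module A X]
    {𝒳 : ℤ → AddSubgroup X} (h𝒳 : IsGradedModule 𝒜 𝒳) {n : ℕ} {b : Fin n → ℤ}
    {f : (Fin n → A) →ₗ[A] X} (hf : ∀ j, f (Pi.single j 1) ∈ 𝒳 (b j)) {i : ℤ} {x : Fin n → A}
    (hx : x ∈ shiftedPiece 𝒜 b i) : f x ∈ 𝒳 i := by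
  rw [pi_eq_sum_univ' x, map_sum]
  refine sum_mem fun j _ => ?_
  rw [map_smul, ← sub_add_cancel i (b j)]
  exact h𝒳.intPiece_smul_mem (mem_shiftedPiece.1 hx j) (hf j)

section

variable [GradedAlgebra 𝒜]

theorem coe_decompose_of_mem_intPiece {i : ℤ} {a : A} (ha : a ∈ intPiece 𝒜 i) (n : ℕ) :
    (DirectSum.decompose 𝒜 a n : A) = if i = n then a else 0 := by
  cases i with
  | ofNat l =>
    rw [DirectSum.decompose_of_mem 𝒜 ha, DirectSum.coe_of_apply]
    simp only [Int.ofNat_eq_natCast, Nat.cast_inj]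
    split_ifs <;> rfl
  | negSucc l =>
    rw [(Submodule.mem_bot k).1 ha, DirectSum.decompose_zero, ite_self]
    rfl

theorem coe_decompose_coeAddMonoidHom_shiftedPiece {n : ℕ} {b : Fin n → ℤ}
    (y : DirectSum ℤ fun i => shiftedPiece 𝒜 b i) (j : Fin n) (i : ℕ) :
    (DirectSum.decompose 𝒜 (DirectSum.coeAddMonoidHom (shiftedPiece 𝒜 b) y j) i : A) =
      (y (i + b j) : Fin n → A) j := by
  classical
  induction y using DirectSum.induction_on with
  | zero =>
    rw [map_zero, Pi.zero_apply, DirectSum.decompose_zero]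
    rfl
  | of l x =>
    rw [DirectSum.coeAddMonoidHom_of, DirectSum.coe_of_apply,
      coe_decompose_of_mem_intPiece (mem_shiftedPiece.1 x.2 j)]
    simp only [sub_eq_iff_eq_add]
    split_ifs <;> rfl
  | add y z hy hz =>
    rw [map_add, Pi.add_apply, DirectSum.decompose_add, DirectSum.add_apply, DirectSum.add_apply,
      Submodule.coe_add, hy, hz]
    rfl

theorem isInternal_shiftedPiece {n : ℕ} (b : Fin n → ℤ) :
    DirectSum.IsInternal (shiftedPiece 𝒜 b) := by
  classical
  refine ⟨(injective_iff_map_eq_zero _).2 fun y hy => ?_, fun x => ?_⟩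
  · ext i j
    have hj := mem_shiftedPiece.1 (y i).2 j
    obtain ⟨l, hl⟩ | ⟨l, hl⟩ : (∃ l : ℕ, i - b j = l) ∨ ∃ l, i - b j = Int.negSucc l := by
      cases i - b j <;> simp
    · have := coe_decompose_coeAddMonoidHom_shiftedPiece y j l
      rw [hy, ← hl, sub_add_cancel, Pi.zero_apply, DirectSum.decompose_zero] at this
      exact this.symm
    · rw [hl] at hj
      exact (Submodule.mem_bot k).1 hj
  · rw [← AddMonoidHom.mem_mrange, ← Finset.univ_sum_single x]
    refine sum_mem fun j _ => ?_
    rw [← DirectSum.sum_support_decompose 𝒜 (x j), ← AddMonoidHom.single_apply, map_sum]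
    exact sum_mem fun i _ => ⟨.of _ _ ⟨_, single_mem_shiftedPiece b j (SetLike.coe_mem _)⟩,
      DirectSum.coeAddMonoidHom_of _ _ _⟩

theorem isGradedModule_shiftedPiece {n : ℕ} (b : Fin n → ℤ) :
    IsGradedModule 𝒜 (shiftedPiece 𝒜 b) where
  isInternal := isInternal_shiftedPiece b
  smul_mem i j a x ha hx := mem_shiftedPiece.2 fun l => by
    have hxl := mem_shiftedPiece.1 hx l
    rw [add_sub_assoc, Pi.smul_apply, smul_eq_mul]
    generalize j - b l = z at *
    cases z with
    | ofNat n => exact SetLike.mul_mem_graded (A := 𝒜) ha hxl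
    | negSucc n =>
      rw [(Submodule.mem_bot k).1 hxl, mul_zero]
      exact zero_mem _

end

/-- A submodule that is generated by homogeneous elements. -/
def IsHomogeneouslyGenerated {X : Type*} [AddCommGroup X] [Module A X]
    {ι : Type*} (𝒳 : ι → AddSubgroup X) (K : Submodule A X) : Prop :=
  ∃ s : Set X, (∀ x ∈ s, SetLike.IsHomogeneousElem 𝒳 x) ∧ Submodule.span A s = K

theorem isHomogeneouslyGenerated_ker {X Y : Type*} [AddCommGroup X] [Module A X] [AddCommGroup Y]
    [Module A Y] {ι : Type*} [DecidableEq ι] {𝒳 : ι → AddSubgroup X} {𝒴 : ι → AddSubgroup Y}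
    (h𝒳 : DirectSum.IsInternal 𝒳) (h𝒴 : DirectSum.IsInternal 𝒴) {f : X →ₗ[A] Y}
    (hf : ∀ i, ∀ x ∈ 𝒳 i, f x ∈ 𝒴 i) : IsHomogeneouslyGenerated 𝒳 (LinearMap.ker f) := by
  classical
  refine ⟨{x | x ∈ LinearMap.ker f ∧ SetLike.IsHomogeneousElem 𝒳 x}, fun x hx => hx.2,
    (Submodule.span_le.2 fun x hx => hx.1).antisymm fun x hx => ?_⟩
  obtain ⟨y, rfl⟩ := h𝒳.surjective x
  let fPiece (i : ι) : 𝒳 i →+ 𝒴 i :=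
    (f.toAddMonoidHom.comp (𝒳 i).subtype).codRestrict (𝒴 i) fun x => hf i x x.2
  have hcomm : (DirectSum.coeAddMonoidHom 𝒴).comp (DirectSum.map fPiece) =
      f.toAddMonoidHom.comp (DirectSum.coeAddMonoidHom 𝒳) := by
    ext i x
    simp only [AddMonoidHom.comp_apply, DirectSum.map_of, DirectSum.coeAddMonoidHom_of]
    rfl
  have hmap : DirectSum.map fPiece y = 0 :=
    h𝒴.injective ((DFunLike.congr_fun hcomm y).trans (hx.trans (map_zero _).symm))
  have hy (i) : f (y i) = 0 :=
    congrArg Subtype.val ((DirectSum.map_apply fPiece i y).symm.trans (DFunLike.congr_fun hmap i))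
  rw [DirectSum.coeAddMonoidHom_eq_dfinsuppSum]
  exact sum_mem fun i _ => Submodule.subset_span ⟨hy i, i, (y i).2⟩

namespace IsStandardGraded

variable [GradedAlgebra 𝒜]

theorem isNoetherianRing (h𝒜 : IsStandardGraded 𝒜) : IsNoetherianRing A := by
  obtain ⟨s, hs⟩ := Module.Finite.iff_fg.1 h𝒜.finite_one
  have : Algebra.FiniteType k A := ⟨⟨s, by rw [← Algebra.adjoin_span, hs, h𝒜.adjoin_one]⟩⟩
  exact Algebra.FiniteType.isNoetherianRing k A

theorem mem_irrelevant_of_not_isUnit (h𝒜 : IsStandardGraded 𝒜) {i : ℤ} {a : A}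
    (ha : a ∈ intPiece 𝒜 i) (hu : ¬ IsUnit a) : a ∈ HomogeneousIdeal.irrelevant 𝒜 := by
  rw [HomogeneousIdeal.mem_irrelevant_iff, GradedRing.proj_apply,
    coe_decompose_of_mem_intPiece ha, ite_eq_right_iff]
  rintro rfl
  obtain ⟨c, rfl⟩ : a ∈ LinearMap.range (Algebra.linearMap k A) := h𝒜.zero_eq ▸ ha
  by_contra hc
  exact hu ((IsUnit.mk0 c fun h => hc (by rw [h, map_zero])).map (algebraMap k A))

theorem le_irrelevant_smul_top (h𝒜 : IsStandardGraded 𝒜) {n : ℕ} {b : Fin n → ℤ}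
    {K : Submodule A (Fin n → A)} (hK : IsHomogeneouslyGenerated (shiftedPiece 𝒜 b) K)
    (hunit : ∀ x ∈ K, ∀ j, ¬ IsUnit (x j)) : K ≤ (HomogeneousIdeal.irrelevant 𝒜).toIdeal • ⊤ := by
  obtain ⟨s, hs, rfl⟩ := hK
  refine Submodule.span_le.2 fun x hx => ?_
  obtain ⟨i, hi⟩ := hs x hx
  exact mem_smul_top_of_forall_mem fun j => h𝒜.mem_irrelevant_of_not_isUnit
    (mem_shiftedPiece.1 hi j) (hunit x (Submodule.subset_span hx) j)

theorem exists_range_eq_and_ker_le (h𝒜 : IsStandardGraded 𝒜) {X : Type*} [AddCommGroup X]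
    [Module A X] {𝒳 : ℤ → AddSubgroup X} (h𝒳 : IsGradedModule 𝒜 𝒳) {K : Submodule A X}
    (hK : IsHomogeneouslyGenerated 𝒳 K) (hfg : K.FG) :
    ∃ (n : ℕ) (b : Fin n → ℤ) (f : (Fin n → A) →ₗ[A] X),
      (∀ j, f (Pi.single j 1) ∈ 𝒳 (b j)) ∧ LinearMap.range f = K ∧
      LinearMap.ker f ≤ (HomogeneousIdeal.irrelevant 𝒜).toIdeal • ⊤ ∧
      IsHomogeneouslyGenerated (shiftedPiece 𝒜 b) (LinearMap.ker f) := by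
  obtain ⟨s, hs, rfl⟩ := hK
  obtain ⟨s', hs', hspan⟩ := (Submodule.fg_span_iff_fg_span_finset_subset s).1 hfg
  obtain ⟨n, f, hfs, hrange, hunit⟩ :=
    exists_range_eq_span_and_not_isUnit (R := A) s'.finite_toSet
  obtain ⟨b, hb⟩ : ∃ b : Fin n → ℤ, ∀ j, f (Pi.single j 1) ∈ 𝒳 (b j) :=
    Classical.skolem.1 fun j => hs _ (hs' (hfs j))
  have hker : IsHomogeneouslyGenerated (shiftedPiece 𝒜 b) (LinearMap.ker f) :=
    isHomogeneouslyGenerated_ker (𝒳 := shiftedPiece 𝒜 b) (𝒴 := 𝒳) (isInternal_shiftedPiece b)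
      h𝒳.isInternal fun _ _ => h𝒳.apply_mem_of_mem_shiftedPiece hb
  exact ⟨n, b, f, hb, hrange.trans hspan.symm, h𝒜.le_irrelevant_smul_top hker hunit, hker⟩

theorem exists_minimalFreeResolution_isGraded (h𝒜 : IsStandardGraded 𝒜) {M : Type v}
    [AddCommGroup M] [Module A M] [Module.Finite A M] {ℳ : ℤ → AddSubgroup M}
    (hℳ : IsGradedModule 𝒜 ℳ) :
    ∃ F : MinimalFreeResolution (HomogeneousIdeal.irrelevant 𝒜).toIdeal M, F.IsGraded 𝒜 ℳ := by
  have := h𝒜.isNoetherianRing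
  let σ := Σ n : ℕ, Σ b : Fin n → ℤ, {K : Submodule A (Fin n → A) //
    K ≤ (HomogeneousIdeal.irrelevant 𝒜).toIdeal • ⊤ ∧
      IsHomogeneouslyGenerated (shiftedPiece 𝒜 b) K}
  have hcover (s : σ) : ∃ (t : σ) (f : (Fin t.1 → A) →ₗ[A] (Fin s.1 → A)),
      (∀ j, f (Pi.single j 1) ∈ shiftedPiece 𝒜 s.2.1 (t.2.1 j)) ∧
      LinearMap.range f = s.2.2.1 ∧ LinearMap.ker f = t.2.2.1 := by
    obtain ⟨n, b, f, hdeg, hrange, hker⟩ := h𝒜.exists_range_eq_and_ker_le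
      (isGradedModule_shiftedPiece s.2.1) s.2.2.2.2 (IsNoetherian.noetherian _)
    exact ⟨⟨n, b, LinearMap.ker f, hker⟩, f, hdeg, hrange, rfl⟩
  choose next d hdeg hrange hker using hcover
  have htop : IsHomogeneouslyGenerated ℳ (⊤ : Submodule A M) :=
    LinearMap.ker_eq_top.2 (rfl : (0 : M →ₗ[A] M) = 0) ▸
      isHomogeneouslyGenerated_ker hℳ.isInternal hℳ.isInternal fun _ _ _ => zero_mem _
  obtain ⟨n, b, ε, hεdeg, hε, hεker⟩ :=
    h𝒜.exists_range_eq_and_ker_le hℳ htop Module.Finite.fg_top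
  exact ⟨.ofIterate (fun s : σ => s.1) next d
    (fun s => LinearMap.exact_iff.2 ((hker s).trans (hrange (next s)).symm))
    (fun s => (hrange s).trans_le s.2.2.2.1) (s₀ := ⟨n, b, LinearMap.ker ε, hεker⟩)
    (LinearMap.range_eq_top.1 hε) (LinearMap.exact_iff.2 (hrange _).symm),
    fun i =>
      (Nat.rec (motive := fun _ => σ) ⟨n, b, LinearMap.ker ε, hεker⟩ (fun _ => next) i).2.1,
    hεdeg, fun _ j => mem_shiftedPiece.1 (hdeg _ j)⟩

end IsStandardGraded

theorem gradedLind_eq_linearityDefect [GradedAlgebra 𝒜] {M : Type u} [AddCommGroup M]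
    [Module A M] {ℳ : ℤ → AddSubgroup M}
    (h : ∃ F : MinimalFreeResolution (HomogeneousIdeal.irrelevant 𝒜).toIdeal M, F.IsGraded 𝒜 ℳ) :
    gradedLind 𝒜 ℳ = linearityDefect (HomogeneousIdeal.irrelevant 𝒜).toIdeal M := by
  have : Nonempty {F : MinimalFreeResolution (HomogeneousIdeal.irrelevant 𝒜).toIdeal M //
    F.IsGraded 𝒜 ℳ} := nonempty_subtype.2 h
  simp only [gradedLind, MinimalFreeResolution.linDefect_eq_linearityDefect, ciSup_const]

end Graded

theorem corollary2p8_general {R : Type u} [CommRing R] (m : Ideal R) {M P N : Type u}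
    [AddCommGroup M] [Module R M] [AddCommGroup P] [Module R P] [AddCommGroup N] [Module R N]
    [Nonempty (MinimalFreeResolution m M)] [Nonempty (MinimalFreeResolution m P)]
    [Nonempty (MinimalFreeResolution m N)] [Nontrivial M] {φ : M →ₗ[R] P} {ψ : P →ₗ[R] N}
    (h : IsShortExact φ ψ) :
    ((linearityDefect m N : WithBot ℕ∞) ≤
      min (max (projdim R P + 1) ((linearityDefect m M + 1 : ℕ∞) : WithBot ℕ∞))
        (max (linearityDefect m P) (projdim R M + 1))) ∧
    ((linearityDefect m P : WithBot ℕ∞) ≤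
      min (max (projdim R M + 1) (linearityDefect m N))
        (max (linearityDefect m M) (projdim R N))) ∧
    ((linearityDefect m M : WithBot ℕ∞) ≤
      min (max ((linearityDefect m N - 1 : ℕ∞) : WithBot ℕ∞) (projdim R P))
        (max (projdim R N) (linearityDefect m P))) ∧
    (Module.Projective R P →
      (1 ≤ linearityDefect m N → linearityDefect m M = linearityDefect m N - 1) ∧
      (¬ 1 ≤ linearityDefect m N → linearityDefect m M = 0)) ∧
    (projdim R M < ⊤ → (linearityDefect m P < ⊤ ↔ linearityDefect m N < ⊤)) ∧
    (projdim R P < ⊤ → (linearityDefect m M < ⊤ ↔ linearityDefect m N < ⊤)) ∧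
    (projdim R N < ⊤ → (linearityDefect m M < ⊤ ↔ linearityDefect m P < ⊤)) := by
  have hN₁ := h.linearityDefect_right_le_max_projdim_middle m
  have hN₂ := h.linearityDefect_right_le_max_projdim_left m
  have hP₁ := h.linearityDefect_middle_le_max_projdim_left m
  have hP₂ := h.linearityDefect_middle_le_max_projdim_right m
  have hM₁ := h.linearityDefect_left_le_max_projdim_middle m
  have hM₂ := h.linearityDefect_left_le_max_projdim_right m
  have le_add_one (x : WithBot ℕ∞) : x ≤ x + 1 := le_add_of_nonneg_right zero_le_one
  have lt_top {a b : ℕ∞} {x : WithBot ℕ∞} (hab : (a : WithBot ℕ∞) ≤ max x b) (hx : x < ⊤)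
      (hb : b < ⊤) : a < ⊤ :=
    WithBot.coe_lt_coe.1 (hab.trans_lt (max_lt hx (WithBot.coe_lt_coe.2 hb)))
  refine ⟨le_min (hN₁.trans (max_le_max_right _ (le_add_one _))) (hN₂.trans (max_comm _ _).le),
    le_min (hP₁.trans (max_le_max_right _ (le_add_one _))) (hP₂.trans (max_comm _ _).le),
    le_min (hM₁.trans (max_comm _ _).le) hM₂, fun _ => ?_, fun hM => ?_, fun hP => ?_, fun hN => ?_⟩
  · rw [h.linearityDefect_left_eq_sub_one m]
    exact ⟨fun _ => rfl, fun hN => tsub_eq_zero_of_le (not_le.1 hN).le⟩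
  · exact ⟨lt_top hN₂ (withBot_add_one_lt_top hM), lt_top hP₁ hM⟩
  · exact ⟨fun hM => lt_top hN₁ hP (WithTop.add_lt_top.2 ⟨hM, WithTop.one_lt_top⟩),
      fun hN => lt_top hM₁ hP (tsub_le_self.trans_lt hN)⟩
  · exact ⟨lt_top hP₂ hN, lt_top hM₂ hN⟩

/-- The linearity defects and projective dimensions in a short exact sequence
`0 → M → P → N → 0` of nonzero finitely generated modules, over a noetherian local ring (first
part) and, for graded modules, over a standard graded algebra (second part). The inequalities are
in `WithBot ℕ∞`. The truncated difference `lind N - 1` is compared with nonnegative numbers only,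
and `⊤ - 1 = ⊤`. -/
theorem corollary2p8 :
    (∀ (R : Type u) [CommRing R] [IsLocalRing R] [IsNoetherianRing R] (M P N : Type u)
      [AddCommGroup M] [Module R M] [AddCommGroup P] [Module R P] [AddCommGroup N] [Module R N]
      [Module.Finite R M] [Module.Finite R P] [Module.Finite R N]
      [Nontrivial M] [Nontrivial P] [Nontrivial N]
      (φ : M →ₗ[R] P) (lam : P →ₗ[R] N),
      Function.Injective φ → Function.Exact φ lam → Function.Surjective lam →
      ((lind R N : WithBot ℕ∞) ≤
        min (max (projdim R P + 1) ((lind R M + 1 : ℕ∞) : WithBot ℕ∞))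
          (max (lind R P) (projdim R M + 1))) ∧
      ((lind R P : WithBot ℕ∞) ≤
        min (max (projdim R M + 1) (lind R N)) (max (lind R M) (projdim R N))) ∧
      ((lind R M : WithBot ℕ∞) ≤
        min (max ((lind R N - 1 : ℕ∞) : WithBot ℕ∞) (projdim R P)) (max (projdim R N) (lind R P))) ∧
      (Module.Free R P →
        (1 ≤ lind R N → lind R M = lind R N - 1) ∧ (¬ 1 ≤ lind R N → lind R M = 0)) ∧
      (projdim R M < ⊤ → (lind R P < ⊤ ↔ lind R N < ⊤)) ∧
      (projdim R P < ⊤ → (lind R M < ⊤ ↔ lind R N < ⊤)) ∧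
      (projdim R N < ⊤ → (lind R M < ⊤ ↔ lind R P < ⊤))) ∧
    (∀ (k : Type w) [Field k] (A : Type u) [CommRing A] [Algebra k A]
      (𝒜 : ℕ → Submodule k A) [GradedAlgebra 𝒜] (M P N : Type u)
      [AddCommGroup M] [Module A M] [AddCommGroup P] [Module A P] [AddCommGroup N] [Module A N]
      [Module.Finite A M] [Module.Finite A P] [Module.Finite A N]
      [Nontrivial M] [Nontrivial P] [Nontrivial N]
      (ℳ : ℤ → AddSubgroup M) (𝒬 : ℤ → AddSubgroup P) (𝒩 : ℤ → AddSubgroup N)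
      (φ : M →ₗ[A] P) (lam : P →ₗ[A] N),
      IsStandardGraded 𝒜 → IsGradedModule 𝒜 ℳ → IsGradedModule 𝒜 𝒬 → IsGradedModule 𝒜 𝒩 →
      (∀ i, ∀ x ∈ ℳ i, φ x ∈ 𝒬 i) → (∀ i, ∀ x ∈ 𝒬 i, lam x ∈ 𝒩 i) →
      Function.Injective φ → Function.Exact φ lam → Function.Surjective lam →
      ((gradedLind 𝒜 𝒩 : WithBot ℕ∞) ≤
        min (max (projdim A P + 1) ((gradedLind 𝒜 ℳ + 1 : ℕ∞) : WithBot ℕ∞))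
          (max (gradedLind 𝒜 𝒬) (projdim A M + 1))) ∧
      ((gradedLind 𝒜 𝒬 : WithBot ℕ∞) ≤
        min (max (projdim A M + 1) (gradedLind 𝒜 𝒩)) (max (gradedLind 𝒜 ℳ) (projdim A N))) ∧
      ((gradedLind 𝒜 ℳ : WithBot ℕ∞) ≤
        min (max ((gradedLind 𝒜 𝒩 - 1 : ℕ∞) : WithBot ℕ∞) (projdim A P))
          (max (projdim A N) (gradedLind 𝒜 𝒬))) ∧
      (Module.Free A P →
        (1 ≤ gradedLind 𝒜 𝒩 → gradedLind 𝒜 ℳ = gradedLind 𝒜 𝒩 - 1) ∧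
        (¬ 1 ≤ gradedLind 𝒜 𝒩 → gradedLind 𝒜 ℳ = 0)) ∧
      (projdim A M < ⊤ → (gradedLind 𝒜 𝒬 < ⊤ ↔ gradedLind 𝒜 𝒩 < ⊤)) ∧
      (projdim A P < ⊤ → (gradedLind 𝒜 ℳ < ⊤ ↔ gradedLind 𝒜 𝒩 < ⊤)) ∧
      (projdim A N < ⊤ → (gradedLind 𝒜 ℳ < ⊤ ↔ gradedLind 𝒜 𝒬 < ⊤))) := by
  constructor
  · intro R _ _ _ M P N _ _ _ _ _ _ _ _ _ _ _ _ φ lam hφ hex hlam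
    simp only [lind_eq_linearityDefect]
    obtain ⟨hN, hP, hM, hfree, hfin⟩ :=
      corollary2p8_general (IsLocalRing.maximalIdeal R) (.mk hφ hex hlam)
    exact ⟨hN, hP, hM, fun _ => hfree inferInstance, hfin⟩
  · intro k _ A _ _ 𝒜 _ M P N _ _ _ _ _ _ _ _ _ _ _ _ ℳ 𝒬 𝒩 φ lam h𝒜 hℳ h𝒬 h𝒩 _ _ hφ hex hlam
    have hFM := h𝒜.exists_minimalFreeResolution_isGraded hℳ
    have hFP := h𝒜.exists_minimalFreeResolution_isGraded h𝒬
    have hFN := h𝒜.exists_minimalFreeResolution_isGraded h𝒩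
    have := hFM.nonempty
    have := hFP.nonempty
    have := hFN.nonempty
    rw [gradedLind_eq_linearityDefect hFM, gradedLind_eq_linearityDefect hFP,
      gradedLind_eq_linearityDefect hFN]
    obtain ⟨hN, hP, hM, hfree, hfin⟩ :=
      corollary2p8_general (HomogeneousIdeal.irrelevant 𝒜).toIdeal (.mk hφ hex hlam)
    exact ⟨hN, hP, hM, fun _ => hfree inferInstance, hfin⟩
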